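/- Consider a stochastic Nash game with agents $i\in\{1,\dots,N\}$, strategies $x_i\in\mathbb R^{n_i}$ and costs $\mathbb J_i(x_i,\boldsymbol x_{-i})=\mathbb E[f_i(x_i,\boldsymbol x_{-i},\xi)]+g_i(x_i)$, where $\xi$ is an $\mathbb R^d$-valued random variable on a probability space $(\Xi,\mathcal F,\mathbb P)$, and $g_i:\mathbb R^{n_i}\to\mathbb R\cup\{+\infty\}$ is lower semicontinuous and convex with nonempty, compact and convex domain $\Omega_i$; put $\boldsymbol\Omega=\prod_i\Omega_i$. Each $f_i:\mathbb R^n\times\mathbb R^d\to\mathbb R$ (with $n=\sum_i n_i$) is measurable, $\mathbb E[f_i(\boldsymbol x,\xi)]$ is well defined (finite) for $\boldsymbol x\in\boldsymbol\Omega$, and, for $\boldsymbol x_{-i}\in\prod_{j\ne i}\Omega_j$ and every value $s$ of the random variable, $f_i(\cdot,\boldsymbol x_{-i},s)$ is convex, continuously differentiable and Lipschitz continuous on an open convex set $U_i\supseteq\Omega_i$ (for instance $U_i=\mathbb R^{n_i}$), with a Lipschitz constant $\ell_i(\boldsymbol x_{-i},s)$ such that $\ell_i(\boldsymbol x_{-i},\xi)$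 is integrable. Let $\mathbb F(\boldsymbol x)=\operatorname{col}\big((\mathbb E[\nabla_{x_i}f_i(\boldsymbol x,\xi)])_i\big)$ be the pseudogradient, and suppose that it is continuous on $\boldsymbol\Omega$. A variational stochastic Nash equilibrium (v-SNE) is a point $\boldsymbol x^*\in\boldsymbol\Omega$ with $$\langle\mathbb F(\boldsymbol x^*),\boldsymbol x-\boldsymbol x^*\rangle+\sum_i g_i(x_i)-\sum_i g_i(x_i^*)\ge 0\quad\text{for all }\boldsymbol x\in\boldsymbol\Omega .$$ Let $\boldsymbol x^*$ be a v-SNE at which $\mathbb F$ is restricted strictly monotone, $\langle\mathbb F(\boldsymbol x)-\mathbb F(\boldsymbol x^*),\boldsymbol x-\boldsymbol x^*\rangle>0$ for all $\boldsymbol x\in\boldsymbol\Omega\setminus\{\boldsymbol x^*\}$, and restricted Lipschitz continuous, $\|\mathbb F(\boldsymbol x)-\mathbb F(\boldsymbol x^*)\|\le L\|\boldsymbol x-\boldsymbol x^*\|$ for some $L$ and all $\boldsymbol x\in\boldsymbol\Omega$. Let $\boldsymbol x^0$ be an $\boldsymbol\Omega$-valued random variable, let $S_k\ge1$ be arbitrary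 batch sizes (for instance constant), let $\xi_i^{k,(t)}$ ($k\ge0$, $1\le i\le N$, $1\le t\le S_k$) be i.i.d. copies of $\xi$, and consider the stochastic forward-backward algorithm with step sizes $\gamma_k>0$ and the sample average approximation $$x_i^{k+1}=\operatorname{prox}_{\gamma_k g_i}\big[x_i^k-\gamma_k\hat F_i^k\big],\qquad \hat F_i^k=\frac1{S_k}\sum_{t=1}^{S_k}\nabla_{x_i}f_i(\boldsymbol x^k,\xi_i^{k,(t)}),\qquad i=1,\dots,N,$$ where $\operatorname{prox}_{h}(v)=\operatorname{argmin}_{u}\{h(u)+\tfrac12\|u-v\|^2\}$. Let $\epsilon_k=\operatorname{col}(\hat F_1^k,\dots,\hat F_N^k)-\mathbb F(\boldsymbol x^k)$, and let $\mathcal F_k$ be the $\sigma$-algebra generated by $\boldsymbol x^0$ and by the samples drawn in iterations $0,\dots,k-1$. Suppose that each $\epsilon_k$ is integrable with $\mathbb E[\epsilon_k\mid\mathcal F_k]=0$ a.s., that $\sum_k\gamma_k=\infty$ and $\sum_k\gamma_k^2<\infty$, and that $\sum_k\gamma_k^2\,\mathbb E[\|\epsilon_k\|^2\mid\mathcal F_k]<\infty$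 a.s. Then the sequence $(\boldsymbol x^k)_{k\in\mathbb N}$ converges almost surely to a v-SNE of the game. In particular, no growth of the batch sizes is required; a constant batch size is allowed. -/

import Mathlib

open MeasureTheory ProbabilityTheory Filter Topology
open scoped ENNReal NNReal

noncomputable section

namespace SNEP

/-- Strategy space `ℝ^{n_i}` of agent `i`, with its Euclidean norm. -/
abbrev Strat {N : ℕ} (n : Fin N → ℕ) (i : Fin N) : Type := EuclideanSpace ℝ (Fin (n i))

/-- Space `ℝ^{n_1} × ⋯ × ℝ^{n_N}` of collective strategies, with its Euclidean norm. -/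
abbrev Profile {N : ℕ} (n : Fin N → ℕ) : Type := PiLp 2 (fun i : Fin N => Strat n i)

/-- The profile `(y, x_{-i})`: agent `i` plays `y`, the others play as in `x`. -/
def replace {N : ℕ} {n : Fin N → ℕ} (x : Profile n) (i : Fin N) (y : Strat n i) : Profile n :=
  WithLp.toLp 2 (Function.update (WithLp.ofLp x) i y)

/-- Effective domain of an extended-real-valued function. -/
def effDom {V : Type*} (h : V → EReal) : Set V := {y | h y < ⊤}

/-- `p = prox_{γ h}(v)`: `p` minimizes `u ↦ γ h(u) + ‖u - v‖² / 2` over the effective domain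
of `h`. -/
def IsProx {V : Type*} [NormedAddCommGroup V] (h : V → EReal) (γ : ℝ) (v p : V) : Prop :=
  p ∈ effDom h ∧ ∀ u ∈ effDom h,
    γ * (h p).toReal + ‖p - v‖ ^ 2 / 2 ≤ γ * (h u).toReal + ‖u - v‖ ^ 2 / 2

/-- Data of a stochastic game: agent `i` has the cost `E[f_i(x_i, x_{-i}, ξ)] + g_i(x_i)`. -/
structure Game {N : ℕ} (n : Fin N → ℕ) (d : ℕ) where
  /-- the random smooth parts -/
  f : Fin N → Profile n → EuclideanSpace ℝ (Fin d) → ℝ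
  /-- the nonsmooth parts -/
  g : (i : Fin N) → Strat n i → EReal

namespace Game

variable {N : ℕ} {n : Fin N → ℕ} {d : ℕ} {Ξ : Type*} [MeasurableSpace Ξ]

/-- Local decision set `Ω_i = dom g_i`. -/
def localSet (G : Game n d) (i : Fin N) : Set (Strat n i) := effDom (G.g i)

/-- The collective feasible set `Ω = ∏ Ω_i`. -/
def feasible (G : Game n d) : Set (Profile n) := {x | ∀ i, x i ∈ G.localSet i}

/-- The partial gradient `∇_{x_i} f_i(x_i, x_{-i}, s)`. -/
def partialGrad (G : Game n d) (i : Fin N) (x : Profile n) (s : EuclideanSpace ℝ (Fin d)) :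
    Strat n i :=
  gradient (fun y : Strat n i => G.f i (replace x i y) s) (x i)

/-- The pseudogradient `𝔽(x) = col (E[∇_{x_i} f_i(x, ξ)])_i`. -/
def pseudoGrad (G : Game n d) (P : Measure Ξ) (ξ : Ξ → EuclideanSpace ℝ (Fin d))
    (x : Profile n) : Profile n :=
  WithLp.toLp 2 (fun i => ∫ ω, G.partialGrad i x (ξ ω) ∂P)

/-- The total nonsmooth cost `∑ g_i(x_i)`, for feasible `x`. -/
def nonsmooth (G : Game n d) (x : Profile n) : ℝ := ∑ i, (G.g i (x i)).toReal

/-- `x` is a variational stochastic Nash equilibrium: a solution of the stochastic variational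
inequality over `Ω` defined by `𝔽` and the functions `g_i`. -/
def IsVSNE (G : Game n d) (P : Measure Ξ) (ξ : Ξ → EuclideanSpace ℝ (Fin d))
    (x : Profile n) : Prop :=
  x ∈ G.feasible ∧ ∀ y ∈ G.feasible,
    0 ≤ inner ℝ (G.pseudoGrad P ξ x) (y - x) + G.nonsmooth y - G.nonsmooth x

/-- Each `g_i : ℝ^{n_i} → ℝ ∪ {+∞}` is lower semicontinuous and convex, with nonempty, compact
and convex domain (convexity of the domain is part of `ConvexOn`). -/
def LocalCosts (G : Game n d) : Prop :=
  ∀ i, (∀ y, G.g i y ≠ ⊥) ∧ LowerSemicontinuous (G.g i) ∧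
    ConvexOn ℝ (G.localSet i) (fun y => (G.g i y).toReal) ∧
    (G.localSet i).Nonempty ∧ IsCompact (G.localSet i)

/-- The functions `f_i` are measurable, with finite expectation at feasible points, and
`f_i(·, x_{-i}, s)` is convex, continuously differentiable and Lipschitz continuous on an open
convex set containing `Ω_i` (for instance the whole space), with a Lipschitz constant
`ℓ_i(x_{-i}, s)` that is integrable in the random variable. -/
def SmoothCosts (G : Game n d) (P : Measure Ξ) (ξ : Ξ → EuclideanSpace ℝ (Fin d)) : Prop :=
  ∀ i, Measurable (fun p : Profile n × EuclideanSpace ℝ (Fin d) => G.f i p.1 p.2) ∧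
    (∀ x ∈ G.feasible, Integrable (fun ω => G.f i x (ξ ω)) P) ∧
    ∃ U : Set (Strat n i), IsOpen U ∧ Convex ℝ U ∧ G.localSet i ⊆ U ∧
      ∀ x ∈ G.feasible,
        (∀ s, ConvexOn ℝ U (fun y => G.f i (replace x i y) s)) ∧
        (∀ s, ContDiffOn ℝ 1 (fun y => G.f i (replace x i y) s) U) ∧
        ∃ ℓ : EuclideanSpace ℝ (Fin d) → ℝ≥0,
          Integrable (fun ω => (ℓ (ξ ω) : ℝ)) P ∧
          ∀ s, LipschitzOnWith (ℓ s) (fun y => G.f i (replace x i y) s) U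

/-- Restricted strict monotonicity on `Ω` of `𝔽` at the point `xs`. -/
def RestrictedStrictMono (G : Game n d) (P : Measure Ξ) (ξ : Ξ → EuclideanSpace ℝ (Fin d))
    (xs : Profile n) : Prop :=
  ∀ x ∈ G.feasible, x ≠ xs → 0 < inner ℝ (G.pseudoGrad P ξ x - G.pseudoGrad P ξ xs) (x - xs)

/-- Restricted Lipschitz continuity on `Ω` of `𝔽` at the point `xs`. -/
def RestrictedLipschitz (G : Game n d) (P : Measure Ξ) (ξ : Ξ → EuclideanSpace ℝ (Fin d))
    (xs : Profile n) : Prop :=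
  ∃ L : ℝ, ∀ x ∈ G.feasible, ‖G.pseudoGrad P ξ x - G.pseudoGrad P ξ xs‖ ≤ L * ‖x - xs‖

/-- Sample average approximation of `𝔽(x)` from `S` samples for each agent. -/
def saa (G : Game n d) {S : ℕ} (s : Fin N → Fin S → EuclideanSpace ℝ (Fin d)) (x : Profile n) :
    Profile n :=
  WithLp.toLp 2 (fun i => (S : ℝ)⁻¹ • ∑ t : Fin S, G.partialGrad i x (s i t))

/-- `x` is a sequence of the stochastic forward-backward algorithm with step sizes `γ`, batch
sizes `S` and samples `ζ k i t` (sample number `t` of agent `i` at iteration `k`), using the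
sample average approximation:
`x_i^{k+1} = prox_{γ_k g_i} (x_i^k - γ_k \hat F_i(x^k))`, starting in `Ω`. -/
def IsFBSequence (G : Game n d) (γ : ℕ → ℝ) (S : ℕ → ℕ)
    (ζ : (k : ℕ) → Fin N → Fin (S k) → Ξ → EuclideanSpace ℝ (Fin d))
    (x : ℕ → Ξ → Profile n) : Prop :=
  ∀ ω, x 0 ω ∈ G.feasible ∧ ∀ k i,
    IsProx (G.g i) (γ k)
      (x k ω i - γ k • G.saa (fun j t => ζ k j t ω) (x k ω) i) (x (k + 1) ω i)

/-- The approximation error `ε_k` of iteration `k`. -/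
def saaError (G : Game n d) (P : Measure Ξ) (ξ : Ξ → EuclideanSpace ℝ (Fin d)) (S : ℕ → ℕ)
    (ζ : (k : ℕ) → Fin N → Fin (S k) → Ξ → EuclideanSpace ℝ (Fin d))
    (x : ℕ → Ξ → Profile n) (k : ℕ) (ω : Ξ) : Profile n :=
  G.saa (fun j t => ζ k j t ω) (x k ω) - G.pseudoGrad P ξ (x k ω)

end Game

/-- The σ-algebra `ℱ_k` generated by the initial point and by all samples drawn before
iteration `k`. -/
abbrev history {N : ℕ} {n : Fin N → ℕ} {d : ℕ} {Ξ : Type*} (S : ℕ → ℕ)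
    (ζ : (k : ℕ) → Fin N → Fin (S k) → Ξ → EuclideanSpace ℝ (Fin d))
    (x₀ : Ξ → Profile n) (k : ℕ) : MeasurableSpace Ξ :=
  MeasurableSpace.comap x₀ inferInstance ⊔
    ⨆ (j : ℕ) (_ : j < k) (i : Fin N) (t : Fin (S j)),
      MeasurableSpace.comap (ζ j i t) inferInstance

/-- All samples are independent (over iterations, agents and sample numbers) and distributed
as `ξ`. -/
def IIDSamples {N d : ℕ} {Ξ : Type*} [MeasurableSpace Ξ] (P : Measure Ξ)
    (ξ : Ξ → EuclideanSpace ℝ (Fin d)) (S : ℕ → ℕ)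
    (ζ : (k : ℕ) → Fin N → Fin (S k) → Ξ → EuclideanSpace ℝ (Fin d)) : Prop :=
  (∀ k i t, Measurable (ζ k i t)) ∧ (∀ k i t, IdentDistrib (ζ k i t) ξ P P) ∧
    iIndepFun (fun p : (Σ k : ℕ, Fin N × Fin (S k)) => ζ p.1 p.2.1 p.2.2) P

/-- The errors have zero conditional mean given the past. -/
def ZeroMeanError {V : Type*} [NormedAddCommGroup V] [NormedSpace ℝ V] [CompleteSpace V]
    {Ξ : Type*} [MeasurableSpace Ξ] (P : Measure Ξ) (ℱ : ℕ → MeasurableSpace Ξ)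
    (ε : ℕ → Ξ → V) : Prop :=
  ∀ k, Integrable (ε k) P ∧ P[ε k | ℱ k] =ᵐ[P] 0

/-- Vanishing positive steps: `∑ γ_k = ∞`, `∑ γ_k² < ∞` and, almost surely,
`∑ γ_k² E[‖ε_k‖² | ℱ_k] < ∞`. -/
def VanishingSteps {V : Type*} [NormedAddCommGroup V]
    {Ξ : Type*} [MeasurableSpace Ξ] (P : Measure Ξ) (ℱ : ℕ → MeasurableSpace Ξ)
    (ε : ℕ → Ξ → V) (γ : ℕ → ℝ) : Prop :=
  (∀ k, 0 < γ k) ∧ ¬ Summable γ ∧ Summable (fun k => γ k ^ 2) ∧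
    ∀ᵐ ω ∂P, ∑' k, ENNReal.ofReal (γ k ^ 2) * (P⁻[fun ω' => ‖ε k ω'‖ₑ ^ 2 | ℱ k]) ω < ∞

end SNEP

end

/-! The limit is the given v-SNE `xs` itself. Its variational inequality makes `xs` a fixed point of
the exact forward-backward step, so the inexact step gives ‖x_{k+1} - xs‖ ≤ ‖w_k - γ_k ε_k‖ with w_k
= x_k - xs - γ_k (𝔽(x_k) - 𝔽(xs)) (`IsVSNE.norm_sub_le_of_isProx`). Squaring shows that D_k = ‖x_k -
xs‖² decreases by 2 γ_k a_k, where a_k = ⟨𝔽(x_k) - 𝔽(xs), x_k - xs⟩ ≥ 0, up to a term C² γ_k² (𝔽 is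
bounded on the compact Ω), the term γ_k² ‖ε_k‖², and a cross term ⟨w_k, ε_k⟩ of zero conditional
mean.

A Robbins–Siegmund argument (`ae_tendsto_and_summable_of_stochastic_descent`) then yields, almost
surely, convergence of D_k and ∑ γ_k a_k < ∞. If D_k had a positive limit, compactness and strict
monotonicity would keep a_k above a positive constant, contradicting ∑ γ_k = ∞
(`tendsto_of_summable_mul_inner`).

The conditional second moments are only almost surely summable, so the supermartingale is built by
localization: increments are switched off once the accumulated conditional variance exceeds a level
m, and m ranges over ℕ. -/

/-! ### Conditional noise estimates and almost sure convergence. -/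

/-- A set integral form of the fact that an integrable noise with zero conditional mean is
orthogonal to bounded random vectors that are measurable with respect to the past. -/
theorem setIntegral_inner_eq_zero_of_condExp_eq_zero {Ω V : Type*} {m m₀ : MeasurableSpace Ω}
    {P : Measure Ω} [IsProbabilityMeasure P] [NormedAddCommGroup V] [InnerProductSpace ℝ V]
    [CompleteSpace V] (hm : m ≤ m₀) {ε w : Ω → V} {W : ℝ} (hε : Integrable ε P)
    (hε0 : P[ε | m] =ᵐ[P] 0) (hw : StronglyMeasurable[m] w) (hW : ∀ ω, ‖w ω‖ ≤ W)
    {s : Set Ω} (hs : MeasurableSet[m] s) :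
    Integrable (fun ω => inner ℝ (w ω) (ε ω)) P ∧ ∫ ω in s, inner ℝ (w ω) (ε ω) ∂P = 0 := by
  have hint : Integrable (fun ω => inner ℝ (w ω) (ε ω)) P :=
    (innerSL ℝ (E := V)).integrable_of_bilin_of_bdd_left W (hw.mono hm).aestronglyMeasurable
      (ae_of_all _ hW) hε
  refine ⟨hint, ?_⟩
  have h := condExp_bilin_of_stronglyMeasurable_left (innerSL ℝ (E := V)) hw hint hε
  rw [← setIntegral_condExp hm hint hs]
  refine integral_eq_zero_of_ae (ae_restrict_of_ae ?_)
  filter_upwards [h, hε0] with ω h1 h2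
  change P[fun ω => inner ℝ (w ω) (ε ω) | m] ω = 0
  refine Eq.trans h1 ?_
  rw [h2]
  simp

/-- If the conditional second moment of `ε` is bounded on an event of the past, then `‖ε‖²` is
integrable there and has the same integral as its conditional expectation. -/
theorem setIntegral_sq_norm_eq_setIntegral_condLExp {Ω V : Type*} {m m₀ : MeasurableSpace Ω}
    {P : Measure Ω} [IsProbabilityMeasure P] [NormedAddCommGroup V]
    (hm : m ≤ m₀) {ε : Ω → V} (hε : AEStronglyMeasurable ε P)
    {s : Set Ω} (hs : MeasurableSet[m] s) {M : ℝ≥0∞} (hM : M ≠ ∞)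
    (hb : ∀ ω ∈ s, (P⁻[fun ω' => ‖ε ω'‖ₑ ^ 2 | m]) ω ≤ M) :
    IntegrableOn (fun ω => ‖ε ω‖ ^ 2) s P ∧
      IntegrableOn (fun ω => ((P⁻[fun ω' => ‖ε ω'‖ₑ ^ 2 | m]) ω).toReal) s P ∧
      ∫ ω in s, ‖ε ω‖ ^ 2 ∂P = ∫ ω in s, ((P⁻[fun ω' => ‖ε ω'‖ₑ ^ 2 | m]) ω).toReal ∂P := by
  have hle : ∫⁻ ω in s, (P⁻[fun ω' => ‖ε ω'‖ₑ ^ 2 | m]) ω ∂P < ∞ := by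
    refine lt_of_le_of_lt (setLIntegral_mono' (hm s hs) hb) ?_
    rw [setLIntegral_const]
    exact ENNReal.mul_lt_top hM.lt_top (measure_lt_top _ _)
  have heq := setLIntegral_condLExp hm P (fun ω' => ‖ε ω'‖ₑ ^ 2) hs
  have hn : ∀ ω, ENNReal.ofReal (‖ε ω‖ ^ 2) = ‖ε ω‖ₑ ^ 2 := fun ω => by
    rw [ENNReal.ofReal_pow (norm_nonneg _), ofReal_norm]
  have hmeas : AEStronglyMeasurable (fun ω => ‖ε ω‖ ^ 2) (P.restrict s) :=
    (hε.norm.pow 2).restrict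
  refine ⟨⟨hmeas, ?_⟩, ?_, ?_⟩
  · rw [hasFiniteIntegral_iff_ofReal (ae_of_all _ fun ω => by positivity)]
    simp_rw [hn]
    rw [← heq]
    exact hle
  · exact integrable_toReal_of_lintegral_ne_top
      (measurable_condLExp' _ _ _).aemeasurable hle.ne
  · rw [integral_eq_lintegral_of_nonneg_ae (ae_of_all _ fun ω => by positivity) hmeas,
      integral_toReal (measurable_condLExp' _ _ _).aemeasurable
        (ae_restrict_of_forall_mem (hm s hs) fun ω hω => (hb ω hω).trans_lt hM.lt_top)]
    simp_rw [hn]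
    rw [heq]

/-- Almost sure convergence of a supermartingale that is bounded below by a constant and starts
at `0`. -/
theorem MeasureTheory.Supermartingale.exists_ae_tendsto_of_bddBelow {Ω : Type*}
    {m₀ : MeasurableSpace Ω}
    {P : Measure Ω} [IsProbabilityMeasure P] {ℱ : Filtration ℕ m₀} {Y : ℕ → Ω → ℝ}
    (hY : Supermartingale Y ℱ P) (h0 : Y 0 = 0) {K : ℝ} (hK : ∀ k ω, -K ≤ Y k ω) :
    ∀ᵐ ω ∂P, ∃ c, Tendsto (fun k => Y k ω) atTop (𝓝 c) := by
  have hbdd : ∀ k, eLpNorm ((-Y) k) 1 P ≤ (Real.toNNReal (2 * K) : ℝ≥0∞) := by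
    intro k
    have hint := hY.integrable k
    have h1 : ∫ ω, Y k ω ∂P ≤ 0 := by
      have := hY.setIntegral_le (Nat.zero_le k) MeasurableSet.univ
      simpa [h0] using this
    -- Since Y ≥ -K, |Y| ≤ Y + 2K; the nonpositive mean then bounds Y in L¹ uniformly in k.
    have h2 : ∫ ω, ‖(-Y) k ω‖ ∂P ≤ 2 * K := by
      calc ∫ ω, ‖(-Y) k ω‖ ∂P ≤ ∫ ω, (Y k ω + 2 * K) ∂P := by
            refine integral_mono hint.neg.norm (hint.add (integrable_const _)) fun ω => ?_
            have hb := hK k ω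
            have hK0 : 0 ≤ K := by have := hK 0 ω; simp [h0] at this; exact this
            simp only [Pi.neg_apply, norm_neg, Real.norm_eq_abs]
            exact abs_le.2 ⟨by linarith, by linarith⟩
        _ = ∫ ω, Y k ω ∂P + 2 * K := by
            rw [integral_add hint (integrable_const _)]; simp
        _ ≤ 2 * K := by linarith
    have h3 : Integrable ((-Y) k) P := hint.neg
    rw [eLpNorm_one_eq_lintegral_enorm, ← ofReal_integral_norm_eq_lintegral_enorm h3]
    exact ENNReal.ofReal_le_ofReal h2
  filter_upwards [hY.neg.exists_ae_tendsto_of_bdd hbdd] with ω ⟨c, hc⟩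
  exact ⟨-c, by simpa using hc.neg⟩

/-- If a nonnegative real sequence `D` decreases, up to summable perturbations `b` and `e`, by
amounts `a ≥ 0`, and the compensated sequence converges, then `D` converges and `a` is
summable. -/
theorem tendsto_and_summable_of_tendsto_compensated {D a b : ℕ → ℝ} {R c : ℝ}
    (hD : ∀ k, D k ≤ R) (hD0 : ∀ k, 0 ≤ D k) (ha : ∀ k, 0 ≤ a k) (hb : Summable b)
    (hc : Tendsto (fun k => ∑ j ∈ Finset.range k, (D (j + 1) - D j - b j + a j)) atTop (𝓝 c)) :
    (∃ l, Tendsto D atTop (𝓝 l)) ∧ Summable a := by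
  have hsum : ∀ k, ∑ j ∈ Finset.range k, (D (j + 1) - D j - b j + a j)
      = D k - D 0 - ∑ j ∈ Finset.range k, b j + ∑ j ∈ Finset.range k, a j := fun k => by
    rw [Finset.sum_add_distrib, Finset.sum_sub_distrib, Finset.sum_range_sub]
  simp_rw [hsum] at hc
  have hbt := hb.hasSum.tendsto_sum_nat
  have hsa : Summable a := by
    obtain ⟨M, hM⟩ := hc.bddAbove_range
    obtain ⟨M', hM'⟩ := hbt.bddAbove_range
    refine summable_of_sum_range_le (c := M + R + M') ha fun k => ?_
    have h1 := hM ⟨k, rfl⟩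
    have h2 := hM' ⟨k, rfl⟩
    have h3 := hD0 k
    have h4 := hD 0
    simp only at h1 h2
    linarith
  refine ⟨⟨_, ((hc.add hbt).sub hsa.hasSum.tendsto_sum_nat).add_const (D 0) |>.congr
    fun k => ?_⟩, hsa⟩
  ring

/-- **Robbins–Siegmund type theorem** for a bounded nonnegative adapted process `D` that
decreases by `2 γ a`, up to a deterministic summable term and to a noise `ε` with zero conditional
mean and almost surely summable weighted conditional second moments. -/
theorem ae_tendsto_and_summable_of_stochastic_descent {Ω V : Type*} {m₀ : MeasurableSpace Ω}
    {P : Measure Ω} [IsProbabilityMeasure P] {ℱ : Filtration ℕ m₀}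
    [NormedAddCommGroup V] [InnerProductSpace ℝ V] [CompleteSpace V]
    {D a : ℕ → Ω → ℝ} {ε w : ℕ → Ω → V} {γ : ℕ → ℝ} {R A C : ℝ} {W : ℕ → ℝ}
    (hDm : ∀ k, StronglyMeasurable[ℱ k] (D k)) (hD0 : ∀ k ω, 0 ≤ D k ω)
    (hDR : ∀ k ω, D k ω ≤ R)
    (ham : ∀ k, StronglyMeasurable[ℱ k] (a k)) (ha0 : ∀ k ω, 0 ≤ a k ω)
    (haA : ∀ k ω, a k ω ≤ A)
    (hwm : ∀ k, StronglyMeasurable[ℱ k] (w k)) (hwW : ∀ k ω, ‖w k ω‖ ≤ W k)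
    (hε : ∀ k, Integrable (ε k) P) (hε0 : ∀ k, P[ε k | ℱ k] =ᵐ[P] 0)
    (hγ : ∀ k, 0 < γ k) (hγ2 : Summable fun k => γ k ^ 2)
    (hv : ∀ᵐ ω ∂P,
      ∑' k, ENNReal.ofReal (γ k ^ 2) * (P⁻[fun ω' => ‖ε k ω'‖ₑ ^ 2 | ℱ k]) ω < ∞)
    (hC : 0 ≤ C)
    (hdesc : ∀ k ω, D (k + 1) ω ≤ D k ω + C * γ k ^ 2 - 2 * γ k * a k ω
      + γ k ^ 2 * ‖ε k ω‖ ^ 2 - 2 * γ k * inner ℝ (w k ω) (ε k ω)) :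
    ∀ᵐ ω ∂P, (∃ l, Tendsto (fun k => D k ω) atTop (𝓝 l)) ∧ Summable fun k => γ k * a k ω := by
  set e : ℕ → Ω → ℝ≥0∞ := fun k => P⁻[fun ω' => ‖ε k ω'‖ₑ ^ 2 | ℱ k] with he
  have hem : ∀ k, Measurable[ℱ k] (e k) := fun k => measurable_condLExp _ _ _
  -- The sum includes index k: `e k` is already ℱ_k-measurable, so {σ_k ≤ m} is an event of ℱ_k that
  -- controls `e k` itself.
  set σ : ℕ → Ω → ℝ≥0∞ := fun k ω =>
    ∑ j ∈ Finset.range (k + 1), ENNReal.ofReal (γ j ^ 2) * e j ω with hσ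
  have hσm : ∀ k, Measurable[ℱ k] (σ k) := fun k =>
    Finset.measurable_fun_sum _ fun j hj =>
      ((hem j).mono (ℱ.mono (Nat.lt_succ_iff.1 (Finset.mem_range.1 hj))) le_rfl).const_mul _
  have hσmono : ∀ ω, Monotone fun k => σ k ω := fun ω i j hij =>
    Finset.sum_le_sum_of_subset (Finset.range_mono (Nat.succ_le_succ hij))
  have hgpos : ∀ k, ENNReal.ofReal (γ k ^ 2) ≠ 0 := fun k => by
    simpa using (hγ k).ne'
  have hterm : ∀ k ω, ENNReal.ofReal (γ k ^ 2) * e k ω ≤ σ k ω := fun k ω =>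
    Finset.single_le_sum (f := fun j => ENNReal.ofReal (γ j ^ 2) * e j ω)
      (fun _ _ => zero_le) (Finset.mem_range.2 (Nat.lt_succ_self k))
  set h : ℕ → Ω → ℝ := fun k ω => D (k + 1) ω - D k ω
    - (C * γ k ^ 2 + γ k ^ 2 * (e k ω).toReal) + 2 * (γ k * a k ω) with hh
  set E : ℕ → ℕ → Set Ω := fun m k => {ω | σ k ω ≤ m} with hE
  have hEm : ∀ m k, MeasurableSet[ℱ k] (E m k) := fun m k =>
    (hσm k) measurableSet_Iic
  -- Compensated process localized at level m. As σ is nondecreasing, the events `E m k` shrink with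
  -- k and the process freezes after the first exit.
  set Y : ℕ → ℕ → Ω → ℝ := fun m k ω => ∑ j ∈ Finset.range k, (E m j).indicator (h j) ω with hY
  have hDi : ∀ k, Integrable (D k) P := fun k =>
    Integrable.of_bound ((hDm k).mono (ℱ.le k)).aestronglyMeasurable R
      (ae_of_all _ fun ω => by rw [Real.norm_of_nonneg (hD0 k ω)]; exact hDR k ω)
  have hai : ∀ k, Integrable (a k) P := fun k =>
    Integrable.of_bound ((ham k).mono (ℱ.le k)).aestronglyMeasurable A
      (ae_of_all _ fun ω => by rw [Real.norm_of_nonneg (ha0 k ω)]; exact haA k ω)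
  have hbound : ∀ m k, ∀ ω ∈ E m k, e k ω ≤ (m : ℝ≥0∞) / ENNReal.ofReal (γ k ^ 2) := by
    intro m k ω hω
    rw [ENNReal.le_div_iff_mul_le (Or.inl (hgpos k)) (Or.inl ENNReal.ofReal_ne_top), mul_comm]
    exact (hterm k ω).trans hω
  have hMtop : ∀ m k, (m : ℕ) / ENNReal.ofReal (γ k ^ 2) ≠ ∞ := fun m k =>
    ENNReal.div_ne_top (ENNReal.natCast_ne_top m) (hgpos k)
  have hhi : ∀ m k, IntegrableOn (h k) (E m k) P := by
    intro m k
    obtain ⟨-, h2, -⟩ := setIntegral_sq_norm_eq_setIntegral_condLExp (ℱ.le k)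
      (hε k).aestronglyMeasurable (hEm m k) (hMtop m k) (hbound m k)
    exact (((hDi (k + 1)).sub (hDi k)).integrableOn.sub
      ((integrable_const _).integrableOn.add (h2.const_mul _))).add
        (((hai k).const_mul _).const_mul _).integrableOn
  have hhm : ∀ k, StronglyMeasurable[ℱ (k + 1)] (h k) := by
    intro k
    have l := ℱ.mono (Nat.le_succ k)
    exact (((hDm (k + 1)).sub ((hDm k).mono l)).sub (stronglyMeasurable_const.add
      (((hem k).mono l le_rfl).ennreal_toReal.stronglyMeasurable.const_mul _))).add
      ((((ham k).mono l).const_mul _).const_mul _)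
  have hsuper : ∀ m, Supermartingale (Y m) ℱ P := by
    intro m
    have hii : ∀ k, Integrable ((E m k).indicator (h k)) P := fun k =>
      (integrable_indicator_iff (ℱ.le k _ (hEm m k))).2 (hhi m k)
    have hYi : ∀ k, Integrable (Y m k) P := fun k => integrable_finsetSum _ fun j _ => hii j
    refine supermartingale_of_setIntegral_succ_le ?_ hYi ?_
    · intro k
      refine Finset.stronglyMeasurable_fun_sum _ fun j hj => ?_
      have l := ℱ.mono (Nat.succ_le_of_lt (Finset.mem_range.1 hj))
      exact ((hhm j).mono l).indicator ((ℱ.mono (Nat.le_succ j)).trans l _ (hEm m j))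
    · intro k s hs
      have hY1 : ∀ ω, Y m (k + 1) ω = Y m k ω + (E m k).indicator (h k) ω := fun ω =>
        Finset.sum_range_succ _ _
      simp_rw [hY1]
      rw [integral_add (hYi k).integrableOn (hii k).integrableOn]
      -- On this event of the past, ‖ε_k‖² and its conditional expectation have equal finite
      -- integrals and the cross term integrates to zero, so the descent inequality leaves a
      -- nonpositive mean increment.
      have hsE : MeasurableSet[ℱ k] (s ∩ E m k) :=
        MeasurableSet.inter hs (hEm m k)
      obtain ⟨i1, i2, i3⟩ := setIntegral_sq_norm_eq_setIntegral_condLExp (ℱ.le k)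
        (hε k).aestronglyMeasurable hsE (hMtop m k) (fun ω hω => hbound m k ω hω.2)
      obtain ⟨j1, j2⟩ := setIntegral_inner_eq_zero_of_condExp_eq_zero (ℱ.le k) (hε k) (hε0 k)
        (hwm k) (hwW k) hsE
      have : ∫ ω in s, (E m k).indicator (h k) ω ∂P ≤ 0 := by
        rw [setIntegral_indicator (ℱ.le k _ (hEm m k))]
        calc ∫ ω in s ∩ E m k, h k ω ∂P
            ≤ ∫ ω in s ∩ E m k, (γ k ^ 2 * ‖ε k ω‖ ^ 2 - γ k ^ 2 * (e k ω).toReal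
                - 2 * γ k * inner ℝ (w k ω) (ε k ω)) ∂P := by
              refine integral_mono ((hhi m k).mono_set Set.inter_subset_right)
                (((i1.const_mul _).sub (i2.const_mul _)).sub
                  (j1.integrableOn.const_mul _)) fun ω => ?_
              have := hdesc k ω
              simp only [hh]
              linarith
          _ = 0 := by
              refine (integral_sub ((i1.const_mul _).sub (i2.const_mul _))
                (j1.integrableOn.const_mul _)).trans ?_
              rw [integral_const_mul, j2, mul_zero, sub_zero]
              refine (integral_sub (i1.const_mul _) (i2.const_mul _)).trans ?_
              rw [integral_const_mul, integral_const_mul, i3, sub_self]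
      linarith
  have hY_eq : ∀ m k ω, ω ∈ E m k → Y m (k + 1) ω = ∑ j ∈ Finset.range (k + 1), h j ω := by
    intro m k ω hω
    refine Finset.sum_congr rfl fun j hj => Set.indicator_of_mem ?_ _
    exact (hσmono ω (Nat.lt_succ_iff.1 (Finset.mem_range.1 hj))).trans hω
  -- Before exit the sum telescopes: D loses at most R, and the two compensators total at most C ∑
  -- γ_j² and m. After exit the value no longer changes.
  have hlow : ∀ m k ω, -(R + C * ∑' j, γ j ^ 2 + m) ≤ Y m k ω := by
    intro m k ω
    have hS0 : 0 ≤ ∑' j, γ j ^ 2 := tsum_nonneg fun j => by positivity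
    have hR0 : 0 ≤ R := (hD0 0 ω).trans (hDR 0 ω)
    induction k with
    | zero =>
      simp only [hY, Finset.range_zero, Finset.sum_empty]
      have : (0 : ℝ) ≤ m := Nat.cast_nonneg m
      have := mul_nonneg hC hS0
      linarith
    | succ k ih =>
      by_cases hω : ω ∈ E m k
      · rw [hY_eq m k ω hω]
        simp only [hh]
        rw [Finset.sum_add_distrib, Finset.sum_sub_distrib,
          Finset.sum_range_sub (fun j => D j ω), Finset.sum_add_distrib, ← Finset.mul_sum]
        have h1 : ∑ j ∈ Finset.range (k + 1), γ j ^ 2 ≤ ∑' j, γ j ^ 2 :=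
          hγ2.sum_le_tsum _ fun j _ => by positivity
        have h2 : ∑ j ∈ Finset.range (k + 1), γ j ^ 2 * (e j ω).toReal ≤ m := by
          have h3 : ∑ j ∈ Finset.range (k + 1), γ j ^ 2 * (e j ω).toReal = (σ k ω).toReal := by
            have hlt : σ k ω < ∞ := lt_of_le_of_lt hω (ENNReal.natCast_lt_top m)
            rw [hσ, ENNReal.toReal_sum fun j hj => ?_]
            · refine Finset.sum_congr rfl fun j _ => ?_
              rw [ENNReal.toReal_mul, ENNReal.toReal_ofReal (by positivity)]
            · exact (((hterm j ω).trans (hσmono ω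
                (Nat.lt_succ_iff.1 (Finset.mem_range.1 hj)))).trans_lt hlt).ne
          rw [h3]
          simpa using ENNReal.toReal_mono (ENNReal.natCast_ne_top m) hω
        have h4 : 0 ≤ ∑ j ∈ Finset.range (k + 1), 2 * (γ j * a j ω) :=
          Finset.sum_nonneg fun j _ => by
            have := mul_nonneg (hγ j).le (ha0 j ω)
            linarith
        have h5 := mul_le_mul_of_nonneg_left h1 hC
        have h6 := hD0 (k + 1) ω
        have h7 := hDR 0 ω
        linarith
      · have : Y m (k + 1) ω = Y m k ω := by
          simp only [hY]
          rw [Finset.sum_range_succ, Set.indicator_of_notMem hω, add_zero]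
        rw [this]
        exact ih
  have hconv : ∀ᵐ ω ∂P, ∀ m, ∃ c, Tendsto (fun k => Y m k ω) atTop (𝓝 c) :=
    ae_all_iff.2 fun m => (hsuper m).exists_ae_tendsto_of_bddBelow
      (by ext ω; simp [hY]) (hlow m)
  filter_upwards [hconv, hv] with ω hc hfin
  -- For a level above the total conditional variance, this ω never exits and the localized process
  -- is the full compensated sum.
  obtain ⟨m, hm⟩ := ENNReal.exists_nat_gt hfin.ne
  have hmem : ∀ k, ω ∈ E m k := fun k => (ENNReal.sum_le_tsum _).trans hm.le
  obtain ⟨c, hc⟩ := hc m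
  have hYh : ∀ k, Y m k ω = ∑ j ∈ Finset.range k, h j ω := fun k =>
    Finset.sum_congr rfl fun j _ => Set.indicator_of_mem (hmem j) _
  simp_rw [hYh] at hc
  have hsumm : Summable fun k => C * γ k ^ 2 + γ k ^ 2 * (e k ω).toReal := by
    refine (hγ2.mul_left C).add ((ENNReal.summable_toReal hfin.ne).congr fun k => ?_)
    rw [ENNReal.toReal_mul, ENNReal.toReal_ofReal (by positivity)]
  obtain ⟨h1, h2⟩ := tendsto_and_summable_of_tendsto_compensated (D := fun k => D k ω)
    (fun k => hDR k ω) (fun k => hD0 k ω)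
    (fun k => mul_nonneg zero_le_two (mul_nonneg (hγ k).le (ha0 k ω))) hsumm hc
  exact ⟨h1, (summable_mul_left_iff two_ne_zero).1 h2⟩

/-! ### Proximal points: variational inequality, nonexpansiveness, continuity. -/

namespace SNEP

section Prox

variable {V : Type*} [NormedAddCommGroup V] [InnerProductSpace ℝ V] {h : V → EReal} {γ : ℝ}

/-- The variational inequality that characterizes a proximal point of a convex function. -/
theorem IsProx.variational {v p u : V} (hp : IsProx h γ v p) (hγ : 0 ≤ γ)
    (hconv : ConvexOn ℝ (effDom h) fun y => (h y).toReal) (hu : u ∈ effDom h) :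
    0 ≤ inner ℝ (p - v) (u - p) + γ * ((h u).toReal - (h p).toReal) := by
  set X : ℝ := inner ℝ (p - v) (u - p) + γ * ((h u).toReal - (h p).toReal)
  -- Minimality of p is tested at (1 - t) p + t u and divided by t; the quadratic remainder vanishes
  -- as t → 0.
  have key : ∀ t ∈ Set.Ioc (0 : ℝ) 1, 0 ≤ X + t * (‖u - p‖ ^ 2 / 2) := by
    intro t ht
    have hmem := hconv.1 hp.1 hu (sub_nonneg.2 ht.2) ht.1.le (by ring)
    have hle := hconv.2 hp.1 hu (sub_nonneg.2 ht.2) ht.1.le (by ring)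
    have hmin := hp.2 _ hmem
    have heq : (1 - t) • p + t • u - v = (p - v) + t • (u - p) := by module
    rw [heq, norm_add_sq_real, inner_smul_right, norm_smul, Real.norm_of_nonneg ht.1.le] at hmin
    simp only [smul_eq_mul] at hle
    have h2 := mul_le_mul_of_nonneg_left hle hγ
    have : 0 ≤ t * (X + t * (‖u - p‖ ^ 2 / 2)) := by
      simp only [X]
      nlinarith
    exact nonneg_of_mul_nonneg_right this ht.1
  have hlim : Tendsto (fun t : ℝ => X + t * (‖u - p‖ ^ 2 / 2)) (𝓝[>] 0) (𝓝 X) := by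
    have : Continuous fun t : ℝ => X + t * (‖u - p‖ ^ 2 / 2) := by fun_prop
    simpa using (this.tendsto 0).mono_left nhdsWithin_le_nhds
  refine ge_of_tendsto hlim ?_
  filter_upwards [Ioc_mem_nhdsGT (zero_lt_one' ℝ)] with t ht using key t ht

/-- The proximal operator of a convex function is nonexpansive. -/
theorem IsProx.norm_sub_le {v w p q : V} (hp : IsProx h γ v p) (hq : IsProx h γ w q)
    (hγ : 0 ≤ γ) (hconv : ConvexOn ℝ (effDom h) fun y => (h y).toReal) :
    ‖p - q‖ ≤ ‖v - w‖ := by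
  have h1 := hp.variational hγ hconv hq.1
  have h2 := hq.variational hγ hconv hp.1
  -- Firm nonexpansiveness: in the sum of the two variational inequalities the values of h cancel.
  have h3 : ‖p - q‖ ^ 2 ≤ inner ℝ (v - w) (p - q) := by
    have e1 : inner ℝ (p - v) (q - p) = - inner ℝ (p - v) (p - q) := by
      rw [← inner_neg_right, neg_sub]
    have e2 : inner ℝ (p - v) (p - q) - inner ℝ (q - w) (p - q)
        = ‖p - q‖ ^ 2 - inner ℝ (v - w) (p - q) := by
      rw [← real_inner_self_eq_norm_sq, ← inner_sub_left, ← inner_sub_left]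
      congr 1
      abel
    linarith
  have h4 := real_inner_le_norm (v - w) (p - q)
  by_contra! hlt
  have := norm_nonneg (v - w)
  nlinarith

/-- In finite dimension, proximal points depend on the base point through a continuous map. -/
theorem exists_continuous_eq_of_isProx [FiniteDimensional ℝ V] (hγ : 0 ≤ γ)
    (hconv : ConvexOn ℝ (effDom h) fun y => (h y).toReal) :
    ∃ T : V → V, Continuous T ∧ ∀ v p, IsProx h γ v p → p = T v := by
  classical
  -- Existence of proximal points is not needed: the map is 1-Lipschitz where they exist, and a
  -- Lipschitz extension covers the other base points.
  set s : Set V := {v | ∃ p, IsProx h γ v p}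
  have hch : ∀ v : V, ∃ p, v ∈ s → IsProx h γ v p := fun v => by
    by_cases hv : v ∈ s
    · exact ⟨hv.choose, fun _ => hv.choose_spec⟩
    · exact ⟨0, fun h => absurd h hv⟩
  choose T₀ hT₀ using hch
  have hlip : LipschitzOnWith 1 T₀ s := LipschitzOnWith.of_dist_le_mul fun v hv w hw => by
    simpa [dist_eq_norm] using (hT₀ v hv).norm_sub_le (hT₀ w hw) hγ hconv
  obtain ⟨T, hT, hTs⟩ := hlip.extend_finite_dimension
  refine ⟨T, hT.continuous, fun v p hp => ?_⟩
  have hv : v ∈ s := ⟨p, hp⟩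
  rw [← hTs hv]
  have := hp.norm_sub_le (hT₀ v hv) hγ hconv
  rw [sub_self, norm_zero] at this
  exact sub_eq_zero.1 (norm_le_zero_iff.1 this)

end Prox

/-! ### Measurability of the sampled gradients and of the iterates. -/

variable {N : ℕ} {n : Fin N → ℕ} {d : ℕ}

theorem replace_self (x : Profile n) (i : Fin N) : replace x i (x i) = x := by
  simp [replace]

/-- Turns a unilateral deviation into translation by a fixed vector, which makes difference
quotients visibly measurable in the profile. -/
theorem replace_add (x : Profile n) (i : Fin N) (c : Strat n i) :
    replace x i (x i + c) = x + WithLp.toLp 2 (Pi.single i c) := by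
  ext j : 1
  rcases eq_or_ne j i with rfl | hj
  · simp [replace]
  · simp [replace, hj]

namespace Game

variable {Ξ : Type*}

theorem isCompact_feasible (G : Game n d) (hg : G.LocalCosts) : IsCompact G.feasible := by
  have h := (isCompact_univ_pi fun i => (hg i).2.2.2.2).image
    (PiLp.continuous_toLp 2 (fun i : Fin N => Strat n i))
  convert h using 1
  ext x
  constructor
  · exact fun hx => ⟨WithLp.ofLp x, fun i _ => hx i, rfl⟩
  · rintro ⟨y, hy, rfl⟩ i
    exact hy i trivial

theorem differentiableAt_of_smoothCosts [MeasurableSpace Ξ] {G : Game n d} {P : Measure Ξ}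
    {ξ : Ξ → EuclideanSpace ℝ (Fin d)} (hf : G.SmoothCosts P ξ) (i : Fin N) {x : Profile n}
    (hx : x ∈ G.feasible) (s : EuclideanSpace ℝ (Fin d)) :
    DifferentiableAt ℝ (fun y : Strat n i => G.f i (replace x i y) s) (x i) := by
  obtain ⟨-, -, U, hU, -, hΩ, h⟩ := hf i
  exact (((h x hx).2.1 s).differentiableOn one_ne_zero).differentiableAt
    (hU.mem_nhds (hΩ (hx i)))

/-- Partial gradients along measurable feasible profiles and measurable parameters are
measurable. -/
theorem measurable_partialGrad_comp [MeasurableSpace Ξ] {G : Game n d} {P : Measure Ξ}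
    {ξ : Ξ → EuclideanSpace ℝ (Fin d)} (hf : G.SmoothCosts P ξ) (i : Fin N)
    {α : Type*} [MeasurableSpace α] {X : α → Profile n} {s : α → EuclideanSpace ℝ (Fin d)}
    (hX : Measurable X) (hXΩ : ∀ a, X a ∈ G.feasible) (hs : Measurable s) :
    Measurable fun a => G.partialGrad i (X a) (s a) := by
  suffices h : Measurable fun a => WithLp.ofLp (G.partialGrad i (X a) (s a)) from
    (WithLp.measurable_toLp 2 _).comp h
  refine measurable_pi_iff.2 fun j => ?_
  have hfm := (hf i).1
  -- Each gradient component is the limit of difference quotients with step 1/m. The shifted profile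
  -- may leave Ω, which is harmless: f_i is measurable everywhere, and the limit needs
  -- differentiability only at the feasible point.
  refine measurable_of_tendsto_metrizable
    (f := fun (m : ℕ) a => (m : ℝ) * (G.f i (replace (X a) i
      (X a i + (m : ℝ)⁻¹ • EuclideanSpace.single j (1 : ℝ))) (s a) - G.f i (X a) (s a)))
    (fun m => ?_) ?_
  · simp_rw [replace_add]
    exact measurable_const.mul ((hfm.comp ((hX.add_const _).prodMk hs)).sub
      (hfm.comp (hX.prodMk hs)))
  · refine tendsto_pi_nhds.2 fun a => ?_
    have hd := differentiableAt_of_smoothCosts hf i (hXΩ a) (s a)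
    have hl := (hd.hasFDerivAt.lim_real (EuclideanSpace.single j (1 : ℝ))).comp
      tendsto_natCast_atTop_atTop
    have he : (G.partialGrad i (X a) (s a)) j
        = fderiv ℝ (fun y : Strat n i => G.f i (replace (X a) i y) (s a)) (X a i)
          (EuclideanSpace.single j (1 : ℝ)) := by
      rw [← inner_gradient_left, EuclideanSpace.inner_single_right]
      simp [partialGrad]
    rw [he]
    refine hl.congr fun m => ?_
    simp [replace_self]

theorem measurable_saa_comp [MeasurableSpace Ξ] {G : Game n d} {P : Measure Ξ}
    {ξ : Ξ → EuclideanSpace ℝ (Fin d)} (hf : G.SmoothCosts P ξ)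
    {α : Type*} [MeasurableSpace α] {S : ℕ} {X : α → Profile n}
    {s : Fin N → Fin S → α → EuclideanSpace ℝ (Fin d)}
    (hX : Measurable X) (hXΩ : ∀ a, X a ∈ G.feasible) (hs : ∀ i t, Measurable (s i t))
    (i : Fin N) : Measurable fun a => G.saa (fun j t => s j t a) (X a) i := by
  change Measurable fun a => (S : ℝ)⁻¹ • ∑ t : Fin S, G.partialGrad i (X a) (s i t a)
  have h : Measurable fun a => ∑ t : Fin S, G.partialGrad i (X a) (s i t a) :=
    Finset.measurable_fun_sum _ fun t _ => measurable_partialGrad_comp hf i hX hXΩ (hs i t)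
  exact h.const_smul (S : ℝ)⁻¹

theorem IsFBSequence.mem_feasible {G : Game n d} {γ : ℕ → ℝ} {S : ℕ → ℕ}
    {ζ : (k : ℕ) → Fin N → Fin (S k) → Ξ → EuclideanSpace ℝ (Fin d)} {x : ℕ → Ξ → Profile n}
    (hx : G.IsFBSequence γ S ζ x) (k : ℕ) (ω : Ξ) : x k ω ∈ G.feasible := by
  cases k with
  | zero => exact (hx ω).1
  | succ k => exact fun i => ((hx ω).2 k i).1

end Game

/-- The filtration of the histories of the algorithm. -/
def historyFiltration {Ξ : Type*} [m₀ : MeasurableSpace Ξ] {S : ℕ → ℕ}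
    {ζ : (k : ℕ) → Fin N → Fin (S k) → Ξ → EuclideanSpace ℝ (Fin d)} {x₀ : Ξ → Profile n}
    (hζ : ∀ k i t, Measurable (ζ k i t)) (hx₀ : Measurable x₀) : Filtration ℕ m₀ where
  seq := history S ζ x₀
  mono' k l hkl := by
    refine sup_le_sup_left ?_ _
    exact biSup_mono fun j hj => lt_of_lt_of_le hj hkl
  le' k := by
    refine sup_le hx₀.comap_le ?_
    refine iSup₂_le fun j _ => ?_
    exact iSup_le fun i => iSup_le fun t => (hζ j i t).comap_le

theorem measurable_sample_history {Ξ : Type*} {S : ℕ → ℕ}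
    {ζ : (k : ℕ) → Fin N → Fin (S k) → Ξ → EuclideanSpace ℝ (Fin d)} {x₀ : Ξ → Profile n}
    {j k : ℕ} (hjk : j < k) (i : Fin N) (t : Fin (S j)) :
    Measurable[history S ζ x₀ k] (ζ j i t) :=
  (comap_measurable (ζ j i t)).mono
    ((le_iSup₂_of_le (f := fun j (_ : j < k) => ⨆ (i : Fin N) (t : Fin (S j)),
      MeasurableSpace.comap (ζ j i t) inferInstance) j hjk
      (le_iSup₂_of_le i t le_rfl)).trans le_sup_right) le_rfl

/-- The iterates of the stochastic forward-backward algorithm are adapted to the history. -/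
theorem Game.IsFBSequence.measurable_history {Ξ : Type*} [MeasurableSpace Ξ] {G : Game n d}
    {P : Measure Ξ} {ξ : Ξ → EuclideanSpace ℝ (Fin d)} (hg : G.LocalCosts)
    (hf : G.SmoothCosts P ξ) {γ : ℕ → ℝ} (hγ : ∀ k, 0 < γ k) {S : ℕ → ℕ}
    {ζ : (k : ℕ) → Fin N → Fin (S k) → Ξ → EuclideanSpace ℝ (Fin d)} {x : ℕ → Ξ → Profile n}
    (hx : G.IsFBSequence γ S ζ x) (hζ : ∀ k i t, Measurable (ζ k i t))
    (hx₀ : Measurable (x 0)) (k : ℕ) :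
    Measurable[history S ζ (x 0) k] (x k) := by
  induction k with
  | zero => exact (comap_measurable (x 0)).mono le_sup_left le_rfl
  | succ k ih =>
    have ih' : Measurable[history S ζ (x 0) (k + 1)] (x k) :=
      ih.mono ((historyFiltration hζ hx₀).mono (Nat.le_succ k)) le_rfl
    suffices h : Measurable[history S ζ (x 0) (k + 1)] fun ω => WithLp.ofLp (x (k + 1) ω) from
      (WithLp.measurable_toLp 2 _).comp h
    refine (@measurable_pi_iff _ _ _ (history S ζ (x 0) (k + 1)) _ _).2 fun i => ?_
    -- The update is specified only as a minimizer; the continuous map T expresses it as a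
    -- measurable function of x_k and the samples of iteration k.
    obtain ⟨T, hT, hTp⟩ := exists_continuous_eq_of_isProx (h := G.g i) (hγ k).le (hg i).2.2.1
    have he : (fun ω => x (k + 1) ω i)
        = fun ω => T (x k ω i - γ k • G.saa (fun j t => ζ k j t ω) (x k ω) i) :=
      funext fun ω => hTp _ _ ((hx ω).2 k i)
    rw [he]
    have h1 : Measurable[history S ζ (x 0) (k + 1)] fun ω => x k ω i :=
      (measurable_pi_apply i).comp ((WithLp.measurable_ofLp 2 _).comp ih')
    have h2 := @measurable_saa_comp N n d Ξ _ G P ξ hf Ξ (history S ζ (x 0) (k + 1)) (S k) (x k)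
      (ζ k) ih' (hx.mem_feasible k)
      (fun i t => measurable_sample_history (Nat.lt_succ_self k) i t) i
    exact hT.measurable.comp (h1.sub (h2.const_smul (γ k)))

end SNEP

/-! ### Descent towards the equilibrium and identification of the limit. -/

namespace SNEP.Game

variable {N : ℕ} {n : Fin N → ℕ} {d : ℕ} {Ξ : Type*} [MeasurableSpace Ξ] {G : Game n d}
  {P : Measure Ξ} {ξ : Ξ → EuclideanSpace ℝ (Fin d)}

/-- The variational inequalities of the local proximal steps, added up over the agents. -/
theorem isProx_variational_sum (hg : G.LocalCosts) {γ : ℝ} (hγ : 0 ≤ γ) {v p u : Profile n}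
    (hp : ∀ i, IsProx (G.g i) γ (v i) (p i)) (hu : u ∈ G.feasible) :
    0 ≤ inner ℝ (p - v) (u - p) + γ * (G.nonsmooth u - G.nonsmooth p) := by
  have h := Finset.sum_nonneg fun i (_ : i ∈ Finset.univ) =>
    (hp i).variational hγ (hg i).2.2.1 (hu i)
  rw [Finset.sum_add_distrib, ← Finset.mul_sum, Finset.sum_sub_distrib] at h
  rw [PiLp.inner_apply]
  exact h

/-- A forward-backward step brings the iterate no further from a v-SNE than the forward step. -/
theorem IsVSNE.norm_sub_le_of_isProx (hg : G.LocalCosts) {xs : Profile n}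
    (hxs : G.IsVSNE P ξ xs) {γ : ℝ} (hγ : 0 ≤ γ) {y F p : Profile n}
    (hp : ∀ i, IsProx (G.g i) γ (y i - γ • F i) (p i)) :
    ‖p - xs‖ ≤ ‖y - xs - γ • (F - G.pseudoGrad P ξ xs)‖ := by
  have h1 := isProx_variational_sum (v := y - γ • F) hg hγ hp hxs.1
  -- Weighted by γ, the equilibrium inequality at p cancels the nonsmooth terms of the proximal
  -- inequality at `xs`.
  have h2 := mul_nonneg hγ (hxs.2 p fun i => (hp i).1)
  set Fs := G.pseudoGrad P ξ xs
  set w := y - xs - γ • (F - Fs) with hw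
  have h3 : ‖p - xs‖ ^ 2 ≤ inner ℝ w (p - xs) := by
    have e1 : inner ℝ (p - (y - γ • F)) (xs - p) = - inner ℝ (p - (y - γ • F)) (p - xs) := by
      rw [← inner_neg_right, neg_sub]
    have e2 : inner ℝ (p - (y - γ • F)) (p - xs) - γ * inner ℝ Fs (p - xs)
        = ‖p - xs‖ ^ 2 - inner ℝ w (p - xs) := by
      rw [← real_inner_self_eq_norm_sq, ← real_inner_smul_left, ← inner_sub_left,
        ← inner_sub_left]
      congr 1
      rw [hw]
      module
    linarith
  have h4 := real_inner_le_norm w (p - xs)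
  by_contra! hlt
  have := norm_nonneg w
  nlinarith

/-- Continuity of 𝔽 is available only on Ω, so it is extended by zero off this compact, hence
measurable, set. -/
theorem measurable_pseudoGrad_comp (hg : G.LocalCosts)
    (hcont : ContinuousOn (G.pseudoGrad P ξ) G.feasible) {α : Type*} [MeasurableSpace α]
    {X : α → Profile n} (hX : Measurable X) (hXΩ : ∀ a, X a ∈ G.feasible) :
    Measurable fun a => G.pseudoGrad P ξ (X a) := by
  classical
  have h := (hcont.measurable_piecewise (continuousOn_const (c := (0 : Profile n)))
    (G.isCompact_feasible hg).measurableSet).comp hX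
  convert h using 1
  funext a
  simp [Set.piecewise, hXΩ a]

/-- A feasible sequence whose distance to `xs` converges and along which the weighted
monotonicity gaps are summable, for non-summable weights, converges to `xs`. -/
theorem tendsto_of_summable_mul_inner (hg : G.LocalCosts)
    (hcont : ContinuousOn (G.pseudoGrad P ξ) G.feasible) {xs : Profile n}
    (hmono : G.RestrictedStrictMono P ξ xs) {γ : ℕ → ℝ} (hγ : ∀ k, 0 < γ k)
    (hγs : ¬ Summable γ) {y : ℕ → Profile n} (hy : ∀ k, y k ∈ G.feasible) {l : ℝ}
    (hl : Tendsto (fun k => ‖y k - xs‖ ^ 2) atTop (𝓝 l))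
    (hsum : Summable fun k =>
      γ k * inner ℝ (G.pseudoGrad P ξ (y k) - G.pseudoGrad P ξ xs) (y k - xs)) :
    Tendsto y atTop (𝓝 xs) := by
  have hl0 : 0 ≤ l := ge_of_tendsto' hl fun k => by positivity
  rcases hl0.eq_or_lt with rfl | hlpos
  · rw [tendsto_iff_norm_sub_tendsto_zero]
    have := hl.sqrt
    simpa using this
  · exfalso
    -- The tail of the sequence stays in this compact set, which avoids `xs`; the gap has a minimum
    -- c > 0 there, so eventually γ_k is at most c⁻¹ times a summable term.
    set K : Set (Profile n) := G.feasible ∩ {z | l / 2 ≤ ‖z - xs‖ ^ 2}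
    have hK : IsCompact K := (G.isCompact_feasible hg).inter_right
      (isClosed_le continuous_const (by fun_prop))
    have hev : ∀ᶠ k in atTop, y k ∈ K := by
      filter_upwards [hl.eventually (lt_mem_nhds (half_lt_self hlpos))] with k hk
      exact ⟨hy k, hk.le⟩
    obtain ⟨k₀, hk₀⟩ := hev.exists
    have hφ : ContinuousOn (fun z =>
        inner ℝ (G.pseudoGrad P ξ z - G.pseudoGrad P ξ xs) (z - xs)) K :=
      ((hcont.mono Set.inter_subset_left).sub continuousOn_const).inner
        (continuousOn_id.sub continuousOn_const)
    obtain ⟨z, hz, hzmin⟩ := hK.exists_isMinOn ⟨_, hk₀⟩ hφ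
    have hzne : z ≠ xs := by
      rintro rfl
      have := hz.2
      simp at this
      linarith
    have hc := hmono z hz.1 hzne
    set c := inner ℝ (G.pseudoGrad P ξ z - G.pseudoGrad P ξ xs) (z - xs)
    refine hγs (Summable.of_norm_bounded_eventually_nat (hsum.mul_left c⁻¹) ?_)
    filter_upwards [hev] with k hk
    rw [Real.norm_of_nonneg (hγ k).le, inv_mul_eq_div, le_div_iff₀ hc]
    exact mul_le_mul_of_nonneg_left (hzmin hk) (hγ k).le

end SNEP.Game

theorem corollary1 {N d : ℕ} {n : Fin N → ℕ} (G : SNEP.Game n d)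
    {Ξ : Type*} [MeasurableSpace Ξ] (P : Measure Ξ) [IsProbabilityMeasure P]
    (ξ : Ξ → EuclideanSpace ℝ (Fin d)) (hξ : Measurable ξ)
    (hg : G.LocalCosts) (hf : G.SmoothCosts P ξ)
    (hcont : ContinuousOn (G.pseudoGrad P ξ) G.feasible)
    (xs : SNEP.Profile n) (hxs : G.IsVSNE P ξ xs)
    (hmono : G.RestrictedStrictMono P ξ xs) (hlip : G.RestrictedLipschitz P ξ xs)
    (S : ℕ → ℕ) (hS : ∀ k, 1 ≤ S k)
    (ζ : (k : ℕ) → Fin N → Fin (S k) → Ξ → EuclideanSpace ℝ (Fin d))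
    (hζ : SNEP.IIDSamples P ξ S ζ)
    (γ : ℕ → ℝ) (x : ℕ → Ξ → SNEP.Profile n) (hx₀ : Measurable (x 0))
    (hx : G.IsFBSequence γ S ζ x)
    (hmean : SNEP.ZeroMeanError P (SNEP.history S ζ (x 0)) (G.saaError P ξ S ζ x))
    (hstep : SNEP.VanishingSteps P (SNEP.history S ζ (x 0)) (G.saaError P ξ S ζ x) γ) :
    ∀ᵐ ω ∂P, ∃ xbar : SNEP.Profile n, G.IsVSNE P ξ xbar ∧
      Tendsto (fun k => x k ω) atTop (𝓝 xbar) := by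
  obtain ⟨hγ, hγs, hγ2, hv⟩ := hstep
  set Fs := G.pseudoGrad P ξ xs with hFs
  set ε := G.saaError P ξ S ζ x with hε
  have hΩ := hx.mem_feasible
  have hcomp := G.isCompact_feasible hg
  obtain ⟨B, hB⟩ := hcomp.exists_bound_of_continuousOn
    (f := fun z => z - xs) (by fun_prop)
  obtain ⟨C, hC⟩ := hcomp.exists_bound_of_continuousOn
    (f := fun z => G.pseudoGrad P ξ z - Fs) (hcont.sub continuousOn_const)
  have hB0 : 0 ≤ B := (norm_nonneg _).trans (hB xs hxs.1)
  have hC0 : 0 ≤ C := (norm_nonneg _).trans (hC xs hxs.1)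
  set ℱ := SNEP.historyFiltration hζ.1 hx₀
  have hxm : ∀ k, Measurable[ℱ k] (x k) := fun k => hx.measurable_history hg hf hγ hζ.1 hx₀ k
  have hFm : ∀ k, Measurable[ℱ k] fun ω => G.pseudoGrad P ξ (x k ω) := fun k =>
    @SNEP.Game.measurable_pseudoGrad_comp N n d Ξ _ G P ξ hg hcont Ξ (ℱ k) (x k) (hxm k) (hΩ k)
  have hd1 : ∀ k, Measurable[ℱ k] fun ω => x k ω - xs := fun k => (hxm k).sub_const _
  have hd2 : ∀ k, Measurable[ℱ k] fun ω => G.pseudoGrad P ξ (x k ω) - Fs := fun k =>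
    (hFm k).sub_const _
  have key := ae_tendsto_and_summable_of_stochastic_descent (P := P) (ℱ := ℱ)
    (D := fun k ω => ‖x k ω - xs‖ ^ 2)
    (a := fun k ω => inner ℝ (G.pseudoGrad P ξ (x k ω) - Fs) (x k ω - xs))
    (ε := ε) (w := fun k ω => x k ω - xs - γ k • (G.pseudoGrad P ξ (x k ω) - Fs))
    -- B bounds ‖x - xs‖ and C bounds ‖𝔽(x) - 𝔽(xs)‖ over Ω. The bound W may depend on k, since it
    -- serves only the integrability of the cross term.
    (γ := γ) (R := B ^ 2) (A := C * B) (W := fun k => B + γ k * C) (C := C ^ 2)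
    (fun k => (hd1 k).stronglyMeasurable.norm.pow 2)
    (fun k ω => by positivity)
    (fun k ω => pow_le_pow_left₀ (norm_nonneg _) (hB _ (hΩ k ω)) 2)
    (fun k => (hd2 k).stronglyMeasurable.inner (hd1 k).stronglyMeasurable)
    (fun k ω => by
      rcases eq_or_ne (x k ω) xs with h | h
      · simp [h]
      · exact (hmono _ (hΩ k ω) h).le)
    (fun k ω => (real_inner_le_norm _ _).trans
      (mul_le_mul (hC _ (hΩ k ω)) (hB _ (hΩ k ω)) (norm_nonneg _) hC0))
    (fun k => (hd1 k).stronglyMeasurable.sub ((hd2 k).stronglyMeasurable.const_smul (γ k)))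
    (fun k ω => (norm_sub_le _ _).trans (add_le_add (hB _ (hΩ k ω)) (by
      rw [norm_smul, Real.norm_of_nonneg (hγ k).le]
      exact mul_le_mul_of_nonneg_left (hC _ (hΩ k ω)) (hγ k).le)))
    (fun k => (hmean k).1) (fun k => (hmean k).2) hγ hγ2 hv (sq_nonneg C)
    (fun k ω => by
      have h1 := hxs.norm_sub_le_of_isProx hg (hγ k).le ((hx ω).2 k)
      have h2 : x k ω - xs - γ k • (G.saa (fun j t => ζ k j t ω) (x k ω) - Fs)
          = (x k ω - xs - γ k • (G.pseudoGrad P ξ (x k ω) - Fs)) - γ k • ε k ω := by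
        simp only [hε, SNEP.Game.saaError]
        module
      rw [← hFs, h2] at h1
      have h3 := pow_le_pow_left₀ (norm_nonneg _) h1 2
      rw [norm_sub_sq_real (x k ω - xs - γ k • (G.pseudoGrad P ξ (x k ω) - Fs)),
        norm_sub_sq_real (x k ω - xs), inner_smul_right, inner_smul_right, norm_smul, norm_smul,
        Real.norm_of_nonneg (hγ k).le,
        real_inner_comm (G.pseudoGrad P ξ (x k ω) - Fs)] at h3
      have h4 := mul_le_mul_of_nonneg_left
        (pow_le_pow_left₀ (norm_nonneg _) (hC _ (hΩ k ω)) 2) (sq_nonneg (γ k))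
      linarith)
  filter_upwards [key] with ω ⟨⟨l, hl⟩, hs⟩
  exact ⟨xs, hxs, SNEP.Game.tendsto_of_summable_mul_inner hg hcont hmono hγ hγs
    (fun k => hΩ k ω) hl hs⟩
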